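/- Let $\Phi:\mathbb R\to\mathbb R$ be a continuously differentiable, strictly convex N-function, i.e. $\Phi(x)=\int_0^{|x|}\varphi(t)\,dt$ with $\varphi:[0,\infty)\to[0,\infty)$ non-decreasing and right-continuous, $\varphi(0)=0$, $\varphi(t)>0$ for $t>0$ and $\lim_{t\to\infty}\varphi(t)=\infty$. Assume $\Phi\in\Delta_2(0)\cap\nabla_2(0)$, that is: there are $x_0>0$ and $K>2$ with $\Phi(2x)\le K\Phi(x)$ for $0\le x\le x_0$, and there are $x_1>0$ and $c>1$ with $\Phi(x)\le\frac1{2c}\Phi(cx)$ for $0\le x\le x_1$. Let $G$ be a group with a finite symmetric generating set $S$ (so $S=S^{-1}$), acting on a countable set $X$. For $f:X\to\mathbb R$ and $g\in G$ put $(\lambda(g)f)(x)=f(g^{-1}x)$. Let $$\ell^\Phi(X)=\Big\{f:X\to\mathbb R \;:\; \sum_{x\in X}\Phi(af(x))<\infty\text{ for some }a>0\Big\},\qquad \|f\|_{(\Phi)}=\inf\Big\{k>0:\sum_{x\in X}\Phi(f(x)/k)\le1\Big\},$$ let $D^\Phi(X)$ be the space of all $f:X\to\mathbb R$ with $\lambda(g)f-f\in\ell^\Phi(X)$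 for every $g\in G$, and let $D^\Phi(X)^G$ be the subspace of the functions in $D^\Phi(X)$ that are constant on $G$-orbits. Equip $D^\Phi(X)$ with the seminorm $\|f\|_{\mathcal D}=\sum_{s\in S}\|\lambda(s)f-f\|_{(\Phi)}$, which induces a norm on $D^\Phi(X)/D^\Phi(X)^G$. Let $\overline{\ell^\Phi_G(X)}$ be the closure of $\ell^\Phi(X)$ in $D^\Phi(X)$ for this seminorm (equivalently, the set of all $u\in D^\Phi(X)$ whose class lies in the closure of the image of $\ell^\Phi(X)$ in $D^\Phi(X)/D^\Phi(X)^G$). Let $HD^\Phi(X)$ be the set of $\Phi$-harmonic functions, i.e. of those $h\in D^\Phi(X)$ with $$(\Delta_\Phi h)(x)=\sum_{s\in S}\Phi'\big(h(s^{-1}x)-h(x)\big)=0\quad\text{for all }x\in X.$$ Then every $f\in D^\Phi(X)$ can be written as $f=u+h$ with $u\in\overline{\ell^\Phi_G(X)}$ and $h\in HD^\Phi(X)$. This decomposition is unique up to an element of $D^\Phi(X)^G$: given one such pair $(u,h)$, the pairs $(u',h')\in\overline{\ell^\Phi_G(X)}\times HD^\Phi(X)$ with $f=u'+h'$ are exactly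 the pairs $(u+c,\,h-c)$ with $c\in D^\Phi(X)^G$. -/

import Mathlib

open scoped ENNReal

noncomputable section

namespace PhiHarmonic

/-- `Φ` is an N-function: `Φ x = ∫₀^{|x|} φ(t) dt`, where `φ` is nondecreasing and right-continuous
on `[0, ∞)`, `φ 0 = 0`, `φ t > 0` for `t > 0`, and `φ t → ∞` as `t → ∞`.
(The values of `φ` at negative arguments play no role.) -/
def IsNFunction (Φ : ℝ → ℝ) : Prop :=
  ∃ φ : ℝ → ℝ,
    MonotoneOn φ (Set.Ici 0) ∧
    (∀ t, 0 ≤ t → ContinuousWithinAt φ (Set.Ici t) t) ∧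
    φ 0 = 0 ∧
    (∀ t, 0 < t → 0 < φ t) ∧
    Filter.Tendsto φ Filter.atTop Filter.atTop ∧
    ∀ x, Φ x = ∫ t in (0 : ℝ)..|x|, φ t

/-- The `Δ₂`-condition for small arguments. -/
def DeltaTwoZero (Φ : ℝ → ℝ) : Prop :=
  ∃ x₀ > (0 : ℝ), ∃ K > (2 : ℝ), ∀ x, 0 ≤ x → x ≤ x₀ → Φ (2 * x) ≤ K * Φ x

/-- The `∇₂`-condition for small arguments. -/
def NablaTwoZero (Φ : ℝ → ℝ) : Prop :=
  ∃ x₀ > (0 : ℝ), ∃ c > (1 : ℝ), ∀ x, 0 ≤ x → x ≤ x₀ → Φ x ≤ 1 / (2 * c) * Φ (c * x)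

variable {G X : Type*}

/-- The modular `ρ_Φ(f) = ∑_{x ∈ X} Φ(f(x)) ∈ [0, ∞]`. (An N-function is nonnegative.) -/
def modular (Φ : ℝ → ℝ) (f : X → ℝ) : ℝ≥0∞ :=
  ∑' x, ENNReal.ofReal (Φ (f x))

/-- The Orlicz space `ℓ^Φ(X)`. -/
def orliczSpace (Φ : ℝ → ℝ) (X : Type*) : Set (X → ℝ) :=
  {f | ∃ a : ℝ, 0 < a ∧ modular Φ (fun x => a * f x) < ∞}

/-- The gauge (Luxemburg) norm on `ℓ^Φ(X)`. (The set below is nonempty for `f ∈ ℓ^Φ(X)`.) -/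
def gaugeNorm (Φ : ℝ → ℝ) (f : X → ℝ) : ℝ :=
  sInf {k : ℝ | 0 < k ∧ modular Φ (fun x => f x / k) ≤ 1}

/-- The permutation representation `(λ_X(g) f)(x) = f(g⁻¹ x)`. -/
def permRep [Group G] [MulAction G X] (g : G) (f : X → ℝ) : X → ℝ :=
  fun x => f (g⁻¹ • x)

/-- The space `D^Φ(X)` of `Φ`-Dirichlet finite functions. -/
def dirichletSpace (Φ : ℝ → ℝ) (G X : Type*) [Group G] [MulAction G X] : Set (X → ℝ) :=
  {f | ∀ g : G, permRep g f - f ∈ orliczSpace Φ X}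

/-- The subspace `D^Φ(X)^G` of the functions in `D^Φ(X)` that are constant on the `G`-orbits. -/
def dirichletInvariants (Φ : ℝ → ℝ) (G X : Type*) [Group G] [MulAction G X] : Set (X → ℝ) :=
  {f | f ∈ dirichletSpace Φ G X ∧ ∀ (g : G) (x : X), f (g • x) = f x}

/-- The Dirichlet norm `∑_{s ∈ S} ‖λ_X(s) f - f‖`, a seminorm on `D^Φ(X)`. Its kernel is
`D^Φ(X)^G` when `S` generates `G`, so that it is the norm of the quotient `D^Φ(X) / D^Φ(X)^G`. -/
def dirichletNorm [Group G] [MulAction G X] (Φ : ℝ → ℝ) (S : Finset G) (f : X → ℝ) : ℝ :=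
  ∑ s ∈ S, gaugeNorm Φ (permRep s f - f)

/-- The functions `u ∈ D^Φ(X)` whose class in `D^Φ(X) / D^Φ(X)^G` lies in the norm closure of
the image `ℓ^Φ(X) / ℓ^Φ(X)^G` of `ℓ^Φ(X)`. -/
def closureOrlicz [Group G] [MulAction G X] (Φ : ℝ → ℝ) (S : Finset G) : Set (X → ℝ) :=
  {u | u ∈ dirichletSpace Φ G X ∧
    ∀ ε : ℝ, 0 < ε → ∃ v ∈ orliczSpace Φ X, dirichletNorm Φ S (u - v) < ε}

/-- The `Φ`-Laplacian `(Δ_Φ f)(x) = ∑_{s ∈ S} Φ'(f(s⁻¹ x) - f(x))`, for differentiable `Φ`. -/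
def phiLaplacian [Group G] [MulAction G X] (Φ : ℝ → ℝ) (S : Finset G) (f : X → ℝ) : X → ℝ :=
  fun x => ∑ s ∈ S, deriv Φ (f (s⁻¹ • x) - f x)

/-- The set `HD^Φ(X)` of `Φ`-harmonic functions in `D^Φ(X)`. -/
def harmonicDirichlet [Group G] [MulAction G X] (Φ : ℝ → ℝ) (S : Finset G) : Set (X → ℝ) :=
  {h | h ∈ dirichletSpace Φ G X ∧ ∀ x, phiLaplacian Φ S h x = 0}

end PhiHarmonic

end

/-!
The decomposition is obtained by minimizing the energy `E k = ∑_{s ∈ S} ∑_x Φ (k (s⁻¹ x) - k x)`,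
the modular of the gradient `grad S k`, over the affine subspace `f + closure (ℓ^Φ)`.

`Δ₂` makes the Orlicz space the set of functions all of whose dilates have finite modular, and turns
approximation in norm into approximation of all dilates in the modular
(`IsStrictYoung.mem_orliczSpace_iff`, `IsStrictYoung.mem_dirichletClosure_iff`). Hence the argument
is carried out with modulars only.

A minimizer exists by the direct method (`IsStrictYoung.exists_energy_minimizer`). Gradients of
bounded energy are bounded pointwise, so a minimizing sequence, normalized on each orbit, has a
pointwise limit, whose energy is minimal by Fatou's lemma. That the limit stays in the closed affine
subspace would follow from reflexivity of `ℓ^Φ` and Mazur's lemma. Instead, the strong approximation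
by convex combinations is shown directly: by `∇₂` the modular has a Banach–Saks property
(`IsStrictYoung.exists_modular_average_le`), because averages of `N` nearly disjoint functions of
bounded modular have small modular for large `N`.

Green's formula (`IsStrictYoung.tsum_deriv_grad_mul_grad`) identifies the first variation of `E`
under finitely supported perturbations with `-2 Δ_Φ`. So minimizers are harmonic, and conversely, by
convexity and density of the finitely supported functions, harmonic functions are minimizers
(`IsStrictYoung.energy_le_of_harmonic`). Two harmonic functions that differ by an element of the
closure then minimize a strictly convex functional of the gradient over the same affine subspace, so
their difference has gradient `0`, that is, it is constant on orbits
(`IsStrictYoung.grad_eq_zero_of_harmonic`).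
-/

namespace PhiHarmonic

open Filter Topology

/-! ### Strictly convex Young functions -/

/-- An even, strictly convex function on `ℝ` vanishing at `0`. These are the properties of an
N-function on which the pointwise estimates rest. -/
structure IsStrictYoung (Φ : ℝ → ℝ) : Prop where
  zero : Φ 0 = 0
  even : ∀ x, Φ (-x) = Φ x
  strictConvex : StrictConvexOn ℝ Set.univ Φ

theorem IsNFunction.isStrictYoung {Φ : ℝ → ℝ} (hΦ : IsNFunction Φ)
    (hconv : StrictConvexOn ℝ Set.univ Φ) : IsStrictYoung Φ := by
  obtain ⟨φ, -, -, -, -, -, h⟩ := hΦ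
  exact ⟨by simp [h], fun x => by simp [h], hconv⟩

namespace IsStrictYoung

variable {Φ : ℝ → ℝ} (h : IsStrictYoung Φ)
include h

theorem convex_comb {a b : ℝ} (ha : 0 ≤ a) (hb : 0 ≤ b) (hab : a + b = 1) (x y : ℝ) :
    Φ (a * x + b * y) ≤ a * Φ x + b * Φ y :=
  h.strictConvex.convexOn.2 (Set.mem_univ x) (Set.mem_univ y) ha hb hab

theorem continuous : Continuous Φ :=
  continuousOn_univ.1 (h.strictConvex.convexOn.continuousOn isOpen_univ)

theorem pos {x : ℝ} (hx : x ≠ 0) : 0 < Φ x := by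
  have hne : x ≠ -x := fun H => hx (by linarith)
  have := h.strictConvex.2 (Set.mem_univ x) (Set.mem_univ (-x)) hne
    (by norm_num : (0 : ℝ) < 1 / 2) (by norm_num : (0 : ℝ) < 1 / 2) (by norm_num)
  simp only [smul_eq_mul, h.even] at this
  rw [show 1 / 2 * x + 1 / 2 * -x = 0 by ring, h.zero] at this
  linarith

theorem nonneg (x : ℝ) : 0 ≤ Φ x := by
  rcases eq_or_ne x 0 with rfl | hx
  · exact h.zero.ge
  · exact (h.pos hx).le

theorem apply_abs (x : ℝ) : Φ |x| = Φ x := by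
  rcases abs_choice x with hx | hx <;> rw [hx]
  exact h.even x

theorem apply_mul_le {c : ℝ} (hc : 0 ≤ c) (hc1 : c ≤ 1) (x : ℝ) : Φ (c * x) ≤ c * Φ x := by
  have := h.convex_comb hc (sub_nonneg.2 hc1) (by ring) x 0
  simpa [h.zero] using this

theorem mono {x y : ℝ} (hxy : |x| ≤ |y|) : Φ x ≤ Φ y := by
  rcases eq_or_ne y 0 with rfl | hy
  · rw [abs_zero] at hxy
    rw [abs_nonpos_iff.1 hxy]
  · have hy' := abs_pos.2 hy
    have hq : |x| / |y| ≤ 1 := (div_le_one hy').2 hxy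
    have := h.apply_mul_le (by positivity) hq |y|
    rw [div_mul_cancel₀ _ hy'.ne', h.apply_abs, h.apply_abs] at this
    nlinarith [h.nonneg y]

theorem abs_le_of_apply_le {x M : ℝ} (hM : Φ x ≤ M) : |x| ≤ 1 + M / Φ 1 := by
  have h1 : 0 < Φ 1 := h.pos one_ne_zero
  have hM0 : 0 ≤ M / Φ 1 := div_nonneg ((h.nonneg x).trans hM) h1.le
  rcases le_total |x| 1 with hx | hx
  · linarith
  · have hx0 : 0 < |x| := by linarith
    have := h.apply_mul_le (inv_nonneg.2 hx0.le) (inv_le_one_of_one_le₀ hx) |x|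
    rw [inv_mul_cancel₀ hx0.ne', h.apply_abs] at this
    have h2 : |x| ≤ M / Φ 1 := by
      rw [le_div_iff₀ h1]
      have h3 : |x| * Φ 1 ≤ |x| * (|x|⁻¹ * Φ x) := by gcongr
      rw [mul_inv_cancel_left₀ hx0.ne'] at h3
      exact h3.trans hM
    linarith

/-- On bounded sets the `Δ₂`-condition near `0` holds with a uniform constant. -/
theorem exists_apply_two_mul_le (hd : DeltaTwoZero Φ) (B : ℝ) :
    ∃ K : ℝ, 0 ≤ K ∧ ∀ x, |x| ≤ B → Φ (2 * x) ≤ K * Φ x := by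
  obtain ⟨x₀, hx₀, K, hK, H⟩ := hd
  have hp := h.pos hx₀.ne'
  refine ⟨max K (Φ (2 * B) / Φ x₀), le_max_of_le_left (by linarith), fun x hx => ?_⟩
  have hnn := h.nonneg x
  rcases le_total |x| x₀ with h0 | h0
  · have := H |x| (abs_nonneg x) h0
    rw [h.apply_abs, ← h.apply_abs, abs_mul, abs_abs, ← abs_mul, h.apply_abs] at this
    exact this.trans (by gcongr; exact le_max_left _ _)
  · have h1 : Φ (2 * x) ≤ Φ (2 * B) := h.mono (by
      rw [abs_mul, abs_mul]
      exact mul_le_mul_of_nonneg_left (hx.trans (le_abs_self B)) (abs_nonneg _))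
    have h2 : Φ x₀ ≤ Φ x := h.mono (by rwa [abs_of_pos hx₀])
    calc Φ (2 * x) ≤ Φ (2 * B) / Φ x₀ * Φ x₀ := by rwa [div_mul_cancel₀ _ hp.ne']
      _ ≤ Φ (2 * B) / Φ x₀ * Φ x := by
        have := h.nonneg (2 * B)
        gcongr
      _ ≤ _ := by gcongr; exact le_max_right _ _

theorem exists_apply_mul_le (hd : DeltaTwoZero Φ) (t B : ℝ) :
    ∃ K : ℝ, 0 ≤ K ∧ ∀ x, |x| ≤ B → Φ (t * x) ≤ K * Φ x := by
  have key : ∀ n : ℕ, ∃ K : ℝ, 0 ≤ K ∧ ∀ x, |x| ≤ B → Φ (2 ^ n * x) ≤ K * Φ x := by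
    intro n
    induction n with
    | zero => exact ⟨1, zero_le_one, fun x _ => by simp⟩
    | succ n ih =>
      obtain ⟨K, hK, H⟩ := ih
      obtain ⟨K', hK', H'⟩ := h.exists_apply_two_mul_le hd (2 ^ n * B)
      refine ⟨K' * K, mul_nonneg hK' hK, fun x hx => ?_⟩
      rw [pow_succ', mul_assoc, mul_assoc]
      refine (H' _ ?_).trans (mul_le_mul_of_nonneg_left (H x hx) hK')
      rw [abs_mul, abs_of_pos (by positivity : (0 : ℝ) < 2 ^ n)]
      gcongr
  obtain ⟨n, hn⟩ := pow_unbounded_of_one_lt |t| (one_lt_two (α := ℝ))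
  obtain ⟨K, hK, H⟩ := key n
  refine ⟨K, hK, fun x hx => (h.mono ?_).trans (H x hx)⟩
  rw [abs_mul, abs_mul, abs_of_pos (by positivity : (0 : ℝ) < 2 ^ n)]
  gcongr

/-- The quantitative content of `∇₂`: on bounded sets `Φ (x / N)` is eventually negligible with
respect to `Φ x / N`. -/
theorem exists_nat_mul_apply_div_le (hn : NablaTwoZero Φ) (B : ℝ) {ε : ℝ} (hε : 0 < ε) :
    ∃ N : ℕ, 0 < N ∧ ∀ x, |x| ≤ B → N * Φ (2 * (x / N)) ≤ ε * Φ x := by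
  obtain ⟨x₁, hx₁, c, hc, H⟩ := hn
  have hc0 : 0 < c := by linarith
  have iter : ∀ j : ℕ, ∀ x, 0 ≤ x → x ≤ x₁ → (2 * c) ^ j * Φ (x / c ^ j) ≤ Φ x := by
    intro j
    induction j with
    | zero => intro x _ _; simp
    | succ j ih =>
      intro x hx hx'
      have h1 := H (x / c ^ (j + 1)) (by positivity)
        ((div_le_self hx (one_le_pow₀ hc.le)).trans hx')
      rw [show c * (x / c ^ (j + 1)) = x / c ^ j by rw [pow_succ]; field_simp] at h1
      have h2 : 2 * c * Φ (x / c ^ (j + 1)) ≤ Φ (x / c ^ j) := by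
        calc 2 * c * Φ (x / c ^ (j + 1)) ≤ 2 * c * (1 / (2 * c) * Φ (x / c ^ j)) := by gcongr
          _ = Φ (x / c ^ j) := by field_simp
      calc (2 * c) ^ (j + 1) * Φ (x / c ^ (j + 1))
          = (2 * c) ^ j * (2 * c * Φ (x / c ^ (j + 1))) := by ring
        _ ≤ (2 * c) ^ j * Φ (x / c ^ j) := by gcongr
        _ ≤ Φ x := ih x hx hx'
  -- `N₀` brings arguments up to `B` into the range of `∇₂`; then `N ≥ 2 N₀ c ^ j`, so that
  -- `2 x / N` is dominated by `x / (N₀ c ^ j)`, and `N ≤ 3 N₀ c ^ j`, which `(2 c) ^ j` beats.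
  obtain ⟨N₀, hN₀1, hN₀⟩ : ∃ N₀ : ℝ, 1 ≤ N₀ ∧ B / x₁ ≤ N₀ :=
    ⟨max 1 (B / x₁), le_max_left _ _, le_max_right _ _⟩
  obtain ⟨j, hj⟩ := pow_unbounded_of_one_lt (3 * N₀ / ε) (one_lt_two (α := ℝ))
  have hcj : 1 ≤ c ^ j := one_le_pow₀ hc.le
  have hr : 1 ≤ N₀ * c ^ j := one_le_mul_of_one_le_of_one_le hN₀1 hcj
  have hN1 := Nat.le_ceil (2 * (N₀ * c ^ j))
  have hN2 := (Nat.ceil_lt_add_one (by positivity : 0 ≤ 2 * (N₀ * c ^ j))).le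
  set N := ⌈2 * (N₀ * c ^ j)⌉₊
  have hNpos : (0 : ℝ) < N := by linarith
  refine ⟨N, by exact_mod_cast hNpos, fun x hx => ?_⟩
  have hN₀0 : 0 < N₀ := by linarith
  have hsmall : |x| / N₀ ≤ x₁ := by
    rw [div_le_iff₀ hN₀0]
    rw [div_le_iff₀ hx₁] at hN₀
    linarith
  have h1 : Φ (2 * (x / N)) ≤ Φ (|x| / N₀ / c ^ j) := h.mono (by
    rw [abs_mul, abs_div, abs_two, abs_of_pos hNpos,
      abs_of_nonneg (by positivity : 0 ≤ |x| / N₀ / c ^ j), div_div, mul_div_assoc', div_le_div_iff₀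
      hNpos (by positivity)]
    nlinarith [abs_nonneg x])
  have h2 := iter j (|x| / N₀) (by positivity) hsmall
  have h3 : Φ (|x| / N₀) ≤ Φ x := h.mono (by
    rw [abs_div, abs_abs, abs_of_pos hN₀0]
    exact div_le_self (abs_nonneg x) hN₀1)
  have h4 : (2 * c) ^ j * Φ (2 * (x / N)) ≤ Φ x :=
    (mul_le_mul_of_nonneg_left h1 (by positivity)).trans (h2.trans h3)
  have hnn := h.nonneg (2 * (x / N))
  rw [div_lt_iff₀ hε] at hj
  calc N * Φ (2 * (x / N)) ≤ 3 * N₀ * c ^ j * Φ (2 * (x / N)) := by gcongr; linarith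
    _ ≤ 2 ^ j * ε * c ^ j * Φ (2 * (x / N)) := by gcongr
    _ = ε * ((2 * c) ^ j * Φ (2 * (x / N))) := by rw [mul_pow]; ring
    _ ≤ ε * Φ x := by gcongr

end IsStrictYoung

/-! ### The modular and the Orlicz space -/

theorem modular_comp_equiv {Φ : ℝ → ℝ} {Y Z : Type*} (e : Z ≃ Y) (f : Y → ℝ) :
    modular Φ (f ∘ e) = modular Φ f :=
  e.tsum_eq fun y => ENNReal.ofReal (Φ (f y))

theorem mem_orliczSpace_of_modular {Φ : ℝ → ℝ} {Y : Type*} {f : Y → ℝ} (hf : modular Φ f ≠ ∞) :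
    f ∈ orliczSpace Φ Y := ⟨1, one_pos, by simpa using hf.lt_top⟩

namespace IsStrictYoung

variable {Φ : ℝ → ℝ} {Y : Type*} (h : IsStrictYoung Φ)
include h

theorem modular_zero : modular Φ (0 : Y → ℝ) = 0 := by
  simp [modular, h.zero]

theorem modular_mono {f g : Y → ℝ} (hfg : ∀ y, |f y| ≤ |g y|) : modular Φ f ≤ modular Φ g :=
  ENNReal.tsum_le_tsum fun y => ENNReal.ofReal_le_ofReal (h.mono (hfg y))

theorem modular_neg (f : Y → ℝ) : modular Φ (-f) = modular Φ f := by
  simp [modular, h.even]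

theorem modular_convex {a b : ℝ} (ha : 0 ≤ a) (hb : 0 ≤ b) (hab : a + b = 1) (f g : Y → ℝ) :
    modular Φ (a • f + b • g) ≤
      ENNReal.ofReal a * modular Φ f + ENNReal.ofReal b * modular Φ g := by
  unfold modular
  rw [← ENNReal.tsum_mul_left, ← ENNReal.tsum_mul_left, ← ENNReal.tsum_add]
  refine ENNReal.tsum_le_tsum fun y => ?_
  rw [← ENNReal.ofReal_mul ha, ← ENNReal.ofReal_mul hb,
    ← ENNReal.ofReal_add (mul_nonneg ha (h.nonneg _)) (mul_nonneg hb (h.nonneg _))]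
  exact ENNReal.ofReal_le_ofReal (h.convex_comb ha hb hab _ _)

theorem modular_smul_le {c : ℝ} (hc : 0 ≤ c) (hc1 : c ≤ 1) (f : Y → ℝ) :
    modular Φ (c • f) ≤ ENNReal.ofReal c * modular Φ f := by
  simpa [h.modular_zero] using h.modular_convex hc (sub_nonneg.2 hc1) (by ring) f 0

theorem modular_add_le (f g : Y → ℝ) :
    modular Φ (f + g) ≤
      2⁻¹ * modular Φ ((2 : ℝ) • f) + 2⁻¹ * modular Φ ((2 : ℝ) • g) := by
  have := h.modular_convex (by norm_num : (0 : ℝ) ≤ 2⁻¹) (by norm_num : (0 : ℝ) ≤ 2⁻¹)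
    (by norm_num) ((2 : ℝ) • f) ((2 : ℝ) • g)
  rwa [inv_smul_smul₀ two_ne_zero, inv_smul_smul₀ two_ne_zero,
    ENNReal.ofReal_inv_of_pos two_pos, ENNReal.ofReal_ofNat] at this

theorem modular_add_le_of_le {f g : Y → ℝ} {M : ℝ≥0∞} (hf : modular Φ ((2 : ℝ) • f) ≤ M)
    (hg : modular Φ ((2 : ℝ) • g) ≤ M) : modular Φ (f + g) ≤ M :=
  calc modular Φ (f + g) ≤ 2⁻¹ * M + 2⁻¹ * M :=
        (h.modular_add_le f g).trans (by gcongr)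
    _ = M := by rw [← add_mul, ENNReal.inv_two_add_inv_two, one_mul]

theorem abs_le_of_modular_le {f : Y → ℝ} {M : ℝ≥0∞} (hM : M ≠ ∞) (hf : modular Φ f ≤ M) (y : Y) :
    |f y| ≤ 1 + M.toReal / Φ 1 :=
  h.abs_le_of_apply_le
    ((ENNReal.ofReal_le_iff_le_toReal hM).1 ((ENNReal.le_tsum y).trans hf))

/-- By `Δ₂`, dilations map modular-bounded sets to modular-bounded sets. -/
theorem exists_modular_smul_le (hd : DeltaTwoZero Φ) (t : ℝ) {M : ℝ≥0∞} (hM : M ≠ ∞) :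
    ∃ K : ℝ≥0∞, K ≠ ∞ ∧ ∀ f : Y → ℝ, modular Φ f ≤ M → modular Φ (t • f) ≤ K := by
  obtain ⟨K, hK, H⟩ := h.exists_apply_mul_le hd t (1 + M.toReal / Φ 1)
  refine ⟨ENNReal.ofReal K * M, ENNReal.mul_ne_top ENNReal.ofReal_ne_top hM, fun f hf => ?_⟩
  refine le_trans ?_ (mul_le_mul_right hf _)
  unfold modular
  rw [← ENNReal.tsum_mul_left]
  refine ENNReal.tsum_le_tsum fun y => ?_
  rw [← ENNReal.ofReal_mul hK]
  exact ENNReal.ofReal_le_ofReal (H _ (h.abs_le_of_modular_le hM hf y))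

/-- By `Δ₂`, a function with finite modular has finite modular after every dilation. -/
theorem mem_orliczSpace_iff (hd : DeltaTwoZero Φ) {f : Y → ℝ} :
    f ∈ orliczSpace Φ Y ↔ ∀ t : ℝ, modular Φ (t • f) ≠ ∞ := by
  refine ⟨?_, fun H => ⟨1, one_pos, (H 1).lt_top⟩⟩
  rintro ⟨a, ha, hfin⟩ t
  obtain ⟨K, hK, H⟩ := h.exists_modular_smul_le (Y := Y) hd (t / a) hfin.ne
  have := H _ le_rfl
  rw [show (t / a) • (fun y => a * f y) = t • f from by
    ext y; simp only [Pi.smul_apply, smul_eq_mul]; field_simp] at this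
  exact ne_top_of_le_ne_top hK this

/-- The Orlicz space as a linear subspace. -/
def orlicz (hd : DeltaTwoZero Φ) (Y : Type*) : Submodule ℝ (Y → ℝ) where
  carrier := orliczSpace Φ Y
  zero_mem' := (h.mem_orliczSpace_iff hd).2 fun t => by simp [h.modular_zero]
  add_mem' := by
    intro f g hf hg
    rw [h.mem_orliczSpace_iff hd] at *
    intro t
    rw [smul_add]
    refine ne_top_of_le_ne_top ?_ (h.modular_add_le _ _)
    simp only [smul_smul]
    exact ENNReal.add_ne_top.2 ⟨ENNReal.mul_ne_top (by simp) (hf _),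
      ENNReal.mul_ne_top (by simp) (hg _)⟩
  smul_mem' := by
    intro c f hf
    simp only [h.mem_orliczSpace_iff hd] at *
    intro t
    rw [smul_smul]
    exact hf _

theorem mem_orlicz (hd : DeltaTwoZero Φ) {f : Y → ℝ} :
    f ∈ h.orlicz hd Y ↔ f ∈ orliczSpace Φ Y := Iff.rfl

theorem modular_ne_top_of_finite_support {v : Y → ℝ} (hv : v.support.Finite) :
    modular Φ v ≠ ∞ := by
  unfold modular
  rw [tsum_eq_sum (s := hv.toFinset)]
  · exact ENNReal.sum_ne_top.2 fun _ _ => ENNReal.ofReal_ne_top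
  · intro y hy
    have : v y = 0 := by simpa using hy
    simp [this, h.zero]

/-- Finitely supported functions are modular-dense in the Orlicz space. -/
theorem exists_finite_support_modular_sub_le {f : Y → ℝ} (hf : modular Φ f ≠ ∞) {ε : ℝ≥0∞}
    (hε : ε ≠ 0) : ∃ F : Finset Y, modular Φ (f - (F : Set Y).indicator f) ≤ ε := by
  have := (ENNReal.tendsto_tsum_compl_atTop_zero hf).eventually (gt_mem_nhds hε.bot_lt)
  obtain ⟨F, hF⟩ := this.exists
  refine ⟨F, le_trans (le_of_eq ?_) hF.le⟩
  unfold modular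
  rw [← tsum_subtype_eq_of_support_subset (s := {y | y ∉ F})]
  · refine tsum_congr fun y => ?_
    have : (y : Y) ∉ F := y.2
    simp [this]
  · intro y hy hyF
    exact hy (by simp [show y ∈ F from hyF, h.zero])

/-- Fatou's lemma for the modular. -/
theorem modular_le_of_tendsto {ι : Type*} {l : Filter ι} [l.NeBot] {a : ι → Y → ℝ} {f : Y → ℝ}
    (ha : ∀ y, Tendsto (fun i => a i y) l (𝓝 (f y))) {m : ι → ℝ≥0∞} {M : ℝ≥0∞}
    (hm : Tendsto m l (𝓝 M)) (hle : ∀ i, modular Φ (a i) ≤ m i) : modular Φ f ≤ M := by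
  unfold modular
  rw [ENNReal.tsum_eq_iSup_sum]
  refine iSup_le fun F => ?_
  refine le_of_tendsto_of_tendsto (tendsto_finsetSum F fun y _ =>
    (ENNReal.continuous_ofReal.comp h.continuous).tendsto _ |>.comp (ha y)) hm ?_
  exact Eventually.of_forall fun i => (ENNReal.sum_le_tsum F).trans (hle i)

/-! ### Averages of pointwise null sequences -/

/-- A weak form of the Brezis–Lieb lemma: where `v` is not small, `b i` is eventually negligible,
and elsewhere convexity bounds `Φ (v + b i)` by `Φ (2 v) / 2 + Φ (2 b i) / 2`. -/
theorem eventually_modular_add_le {ι : Type*} {l : Filter ι} {b : ι → Y → ℝ}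
    (hb : ∀ y, Tendsto (fun i => b i y) l (𝓝 0)) {v : Y → ℝ}
    (hv : modular Φ ((2 : ℝ) • v) ≠ ∞) {ε : ℝ≥0∞} (hε : ε ≠ 0) :
    ∀ᶠ i in l, modular Φ (v + b i) ≤ modular Φ v + ε + modular Φ ((2 : ℝ) • b i) := by
  have hε2 : ε / 2 ≠ 0 := by simpa using hε
  obtain ⟨F, hF⟩ := ((ENNReal.tendsto_tsum_compl_atTop_zero hv).eventually
    (gt_mem_nhds hε2.bot_lt)).exists
  have hlim : Tendsto (fun i => ∑ y ∈ F, ENNReal.ofReal (Φ (v y + b i y))) l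
      (𝓝 (∑ y ∈ F, ENNReal.ofReal (Φ (v y)))) := by
    refine tendsto_finsetSum F fun y _ => ?_
    refine ((ENNReal.continuous_ofReal.comp h.continuous).tendsto _).comp ?_
    simpa using (hb y).const_add (v y)
  have hlt : ∑ y ∈ F, ENNReal.ofReal (Φ (v y)) < ∑ y ∈ F, ENNReal.ofReal (Φ (v y)) + ε / 2 :=
    ENNReal.lt_add_right (ENNReal.sum_ne_top.2 fun _ _ => ENNReal.ofReal_ne_top) hε2
  filter_upwards [hlim.eventually (gt_mem_nhds hlt)] with i hi
  have hsplit : modular Φ (v + b i) = ∑ y ∈ F, ENNReal.ofReal (Φ (v y + b i y)) +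
      ∑' y : {y // y ∉ F}, ENNReal.ofReal (Φ (v y + b i y)) :=
    (ENNReal.sum_add_tsum_compl F _).symm
  have htail : ∑' y : {y // y ∉ F}, ENNReal.ofReal (Φ (v y + b i y)) ≤
      ε / 2 + modular Φ ((2 : ℝ) • b i) := by
    have h1 := h.modular_add_le (fun y : {y // y ∉ F} => v y) (fun y : {y // y ∉ F} => b i y)
    have h2 : modular Φ ((2 : ℝ) • fun y : {y // y ∉ F} => v y) ≤ ε / 2 := hF.le
    have h3 : modular Φ ((2 : ℝ) • fun y : {y // y ∉ F} => b i y) ≤ modular Φ ((2 : ℝ) • b i) :=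
      ENNReal.tsum_comp_le_tsum_of_injective Subtype.val_injective
        fun y => ENNReal.ofReal (Φ (2 * b i y))
    have h4 : (2⁻¹ : ℝ≥0∞) ≤ 1 := by simp
    calc _ ≤ _ := h1
      _ ≤ 1 * (ε / 2) + 1 * modular Φ ((2 : ℝ) • b i) := by gcongr
      _ = _ := by simp
  calc modular Φ (v + b i)
      ≤ (∑ y ∈ F, ENNReal.ofReal (Φ (v y)) + ε / 2) + (ε / 2 + modular Φ ((2 : ℝ) • b i)) := by
        rw [hsplit]; gcongr
    _ = ∑ y ∈ F, ENNReal.ofReal (Φ (v y)) + ε + modular Φ ((2 : ℝ) • b i) := by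
        rw [add_assoc, ← add_assoc (ε / 2), ENNReal.add_halves, add_assoc]
    _ ≤ _ := by gcongr; exact ENNReal.sum_le_tsum F

/-- Banach–Saks property of the modular: a modular-bounded family tending pointwise to `0` has
averages of arbitrarily small modular. The members are chosen one after another, nearly disjoint
from the previous ones, so that the modular of the average of `N` members is about `N` times that
of one member divided by `N`; this is small by `∇₂`. -/
theorem exists_modular_average_le (hd : DeltaTwoZero Φ) (hn : NablaTwoZero Φ) {ι : Type*}
    {l : Filter ι} [l.NeBot] {a : ι → Y → ℝ} (ha : ∀ y, Tendsto (fun i => a i y) l (𝓝 0))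
    {M : ℝ≥0∞} (hM : M ≠ ∞) (hle : ∀ i, modular Φ (a i) ≤ M) :
    ∃ (N : ℕ) (j : Fin N → ι), 0 < N ∧ modular Φ ((N : ℝ)⁻¹ • ∑ k, a (j k)) ≤ 1 := by
  have hM1 : 0 < M.toReal + 1 := by positivity
  obtain ⟨N, hN, H⟩ := h.exists_nat_mul_apply_div_le hn (1 + M.toReal / Φ 1)
    (ε := (2 * (M.toReal + 1))⁻¹) (by positivity)
  have hN' : (N : ℝ≥0∞) ≠ 0 := by exact_mod_cast hN.ne'
  have hNr : (0 : ℝ) < N := by exact_mod_cast hN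
  -- Each of the `N` steps below costs at most this bound twice, that is, at most `1 / N`.
  have hsmall : ∀ i, modular Φ ((2 : ℝ) • ((N : ℝ)⁻¹ • a i)) ≤ 2⁻¹ * (N : ℝ≥0∞)⁻¹ := by
    intro i
    have h1 : (N : ℝ≥0∞) * modular Φ ((2 : ℝ) • ((N : ℝ)⁻¹ • a i)) ≤
        ENNReal.ofReal (2 * (M.toReal + 1))⁻¹ * modular Φ (a i) := by
      unfold modular
      rw [← ENNReal.tsum_mul_left, ← ENNReal.tsum_mul_left]
      refine ENNReal.tsum_le_tsum fun y => ?_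
      rw [← ENNReal.ofReal_mul (by positivity), ← ENNReal.ofReal_natCast,
        ← ENNReal.ofReal_mul hNr.le]
      refine ENNReal.ofReal_le_ofReal ?_
      have := H _ (h.abs_le_of_modular_le hM (hle i) y)
      rwa [div_eq_inv_mul] at this
    have h2 : ENNReal.ofReal (2 * (M.toReal + 1))⁻¹ * modular Φ (a i) ≤ 2⁻¹ := by
      calc _ ≤ ENNReal.ofReal (2 * (M.toReal + 1))⁻¹ * ENNReal.ofReal (M.toReal + 1) := by
            gcongr
            refine (hle i).trans ?_
            rw [ENNReal.le_ofReal_iff_toReal_le hM hM1.le]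
            linarith
        _ = 2⁻¹ := by
            rw [← ENNReal.ofReal_mul (by positivity), mul_inv, mul_assoc,
              inv_mul_cancel₀ hM1.ne', mul_one, ENNReal.ofReal_inv_of_pos two_pos,
              ENNReal.ofReal_ofNat]
    rw [← div_eq_mul_inv, ENNReal.le_div_iff_mul_le (Or.inl hN') (Or.inl (by simp)), mul_comm]
    exact h1.trans h2
  have hb : ∀ y, Tendsto (fun i => ((N : ℝ)⁻¹ • a i) y) l (𝓝 0) := fun y => by
    simpa using (ha y).const_mul ((N : ℝ)⁻¹)
  have key : ∀ n : ℕ, ∃ j : Fin n → ι,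
      modular Φ (∑ k, (N : ℝ)⁻¹ • a (j k)) ≤ n * (N : ℝ≥0∞)⁻¹ := by
    intro n
    induction n with
    | zero => exact ⟨Fin.elim0, by simp [h.modular_zero]⟩
    | succ n ih =>
      obtain ⟨j, hj⟩ := ih
      have hfin : modular Φ ((2 : ℝ) • ∑ k, (N : ℝ)⁻¹ • a (j k)) ≠ ∞ := by
        obtain ⟨K, hK, HK⟩ := h.exists_modular_smul_le (Y := Y) hd 2
          (M := n * (N : ℝ≥0∞)⁻¹) (ENNReal.mul_ne_top (by simp) (by simpa using hN'))
        exact ne_top_of_le_ne_top hK (HK _ hj)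
      obtain ⟨i, hi⟩ := (h.eventually_modular_add_le hb hfin
        (ε := 2⁻¹ * (N : ℝ≥0∞)⁻¹) (by simp)).exists
      refine ⟨Fin.snoc j i, ?_⟩
      rw [Fin.sum_univ_castSucc]
      simp only [Fin.snoc_castSucc, Fin.snoc_last]
      calc _ ≤ _ := hi
        _ ≤ n * (N : ℝ≥0∞)⁻¹ + 2⁻¹ * (N : ℝ≥0∞)⁻¹ + 2⁻¹ * (N : ℝ≥0∞)⁻¹ := by
          gcongr
          exact hsmall i
        _ = _ := by
          rw [add_assoc, ← add_mul, ENNReal.inv_two_add_inv_two]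
          push_cast
          ring
  obtain ⟨j, hj⟩ := key N
  refine ⟨N, j, hN, ?_⟩
  rw [Finset.smul_sum]
  rwa [ENNReal.mul_inv_cancel hN' (by simp)] at hj

end IsStrictYoung

/-! ### The gradient and the Dirichlet space -/

variable {G X : Type*} [Group G] [MulAction G X]

/-- The gradient `(s, x) ↦ f (s⁻¹ x) - f x` along the generators; it collects the differences
`λ(s) f - f`, `s ∈ S`, into one function. -/
def grad (S : Finset G) : (X → ℝ) →ₗ[ℝ] (S × X → ℝ) where
  toFun f p := f ((p.1 : G)⁻¹ • p.2) - f p.2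
  map_add' f g := by ext p; simp only [Pi.add_apply]; ring
  map_smul' c f := by ext p; simp only [Pi.smul_apply, smul_eq_mul, RingHom.id_apply]; ring

theorem grad_apply (S : Finset G) (f : X → ℝ) (s : S) (x : X) :
    grad S f (s, x) = f ((s : G)⁻¹ • x) - f x := rfl

theorem modular_smul_grad (Φ : ℝ → ℝ) (S : Finset G) (t : ℝ) (f : X → ℝ) :
    modular Φ (t • grad S f) = ∑ s ∈ S, modular Φ (t • (permRep s f - f)) := by
  rw [← Finset.sum_coe_sort, ← tsum_fintype (L := .unconditional _)]
  exact ENNReal.tsum_prod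
    (f := fun (s : S) (x : X) => ENNReal.ofReal (Φ (t * (f ((s : G)⁻¹ • x) - f x))))

theorem modular_permRep (Φ : ℝ → ℝ) (g : G) (f : X → ℝ) :
    modular Φ (permRep g f) = modular Φ f :=
  modular_comp_equiv (MulAction.toPerm g⁻¹) f

theorem permRep_mem_orliczSpace {Φ : ℝ → ℝ} (g : G) {f : X → ℝ} (hf : f ∈ orliczSpace Φ X) :
    permRep g f ∈ orliczSpace Φ X := by
  obtain ⟨a, ha, h⟩ := hf
  exact ⟨a, ha, by rwa [← modular_permRep Φ g] at h⟩

/-- A function with vanishing gradient along a generating set is constant on orbits. -/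
theorem apply_smul_eq_of_grad_eq_zero {S : Finset G} (hS : Subgroup.closure (S : Set G) = ⊤)
    {f : X → ℝ} (hf : grad S f = 0) (g : G) (x : X) : f (g • x) = f x := by
  have hg : g ∈ Subgroup.closure (S : Set G) := hS ▸ Subgroup.mem_top g
  induction hg using Subgroup.closure_induction generalizing x with
  | mem s hs =>
    have := congrFun hf (⟨s, hs⟩, s • x)
    rw [grad_apply, inv_smul_smul, Pi.zero_apply] at this
    linarith
  | one => rw [one_smul]
  | mul a b _ _ iha ihb => rw [mul_smul, iha, ihb]
  | inv a _ ih => rw [← ih (a⁻¹ • x), smul_inv_smul]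

theorem grad_eq_zero_of_invariant {S : Finset G} {f : X → ℝ} (hf : ∀ (g : G) x, f (g • x) = f x) :
    grad S f = 0 := by
  ext ⟨s, x⟩
  simp [grad_apply, hf]

/-- A bound on the gradients of a family bounds its increments along orbits pointwise. -/
theorem exists_abs_sub_le_of_grad {S : Finset G} (hS : Subgroup.closure (S : Set G) = ⊤)
    {ι : Type*} {f : ι → X → ℝ} {B : ℝ} (hf : ∀ i p, |grad S (f i) p| ≤ B) (g : G) (x : X) :
    ∃ C, ∀ i, |f i (g • x) - f i x| ≤ C := by
  have hg : g ∈ Subgroup.closure (S : Set G) := hS ▸ Subgroup.mem_top g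
  induction hg using Subgroup.closure_induction generalizing x with
  | mem s hs =>
    refine ⟨B, fun i => ?_⟩
    have := hf i (⟨s, hs⟩, s • x)
    rwa [grad_apply, inv_smul_smul, abs_sub_comm] at this
  | one => exact ⟨0, fun i => by simp⟩
  | mul a b _ _ iha ihb =>
    obtain ⟨C, hC⟩ := iha (b • x)
    obtain ⟨C', hC'⟩ := ihb x
    refine ⟨C + C', fun i => ?_⟩
    rw [mul_smul]
    exact (abs_sub_le _ (f i (b • x)) _).trans (add_le_add (hC i) (hC' i))
  | inv a _ ih =>
    obtain ⟨C, hC⟩ := ih (a⁻¹ • x)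
    refine ⟨C, fun i => ?_⟩
    have := hC i
    rwa [smul_inv_smul, abs_sub_comm] at this

theorem finite_support_grad (S : Finset G) {v : X → ℝ} (hv : v.support.Finite) :
    (grad S v).support.Finite := by
  have hfin : (⋃ s : S, (fun x => (s, (s : G) • x)) '' v.support ∪
      (Prod.mk s) '' v.support).Finite :=
    Set.finite_iUnion fun s => (hv.image _).union (hv.image _)
  refine hfin.subset ?_
  rintro ⟨s, x⟩ hp
  simp only [Set.mem_iUnion]
  refine ⟨s, ?_⟩
  by_cases hx : v x = 0
  · refine Or.inl ⟨(s : G)⁻¹ • x, fun H => hp ?_, by simp⟩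
    rw [grad_apply, H, hx, sub_zero]
  · exact Or.inr ⟨x, hx, rfl⟩

/-- The set in the definition of the gauge norm is nonempty on the Orlicz space, so that the norm
is a genuine infimum there. -/
theorem IsStrictYoung.exists_modular_div_le {Φ : ℝ → ℝ} (h : IsStrictYoung Φ) {Y : Type*}
    {f : Y → ℝ} (hf : f ∈ orliczSpace Φ Y) :
    {k : ℝ | 0 < k ∧ modular Φ (fun y => f y / k) ≤ 1}.Nonempty := by
  obtain ⟨a, ha, hfin⟩ := hf
  set M : ℝ := (modular Φ fun y => a * f y).toReal + 1
  have hM : 1 ≤ M := by simp [M]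
  have hM0 : 0 < M := by linarith
  refine ⟨M / a, by positivity, ?_⟩
  have := h.modular_smul_le (inv_nonneg.2 hM0.le) (inv_le_one_of_one_le₀ hM) fun y => a * f y
  rw [show (fun y => f y / (M / a)) = M⁻¹ • fun y => a * f y from by
    ext y; simp only [Pi.smul_apply, smul_eq_mul]; field_simp]
  refine this.trans ?_
  calc _ ≤ ENNReal.ofReal M⁻¹ * ENNReal.ofReal M := by
        gcongr
        rw [ENNReal.le_ofReal_iff_toReal_le hfin.ne hM0.le]
        simp [M]
    _ = 1 := by rw [← ENNReal.ofReal_mul (by positivity), inv_mul_cancel₀ hM0.ne',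
      ENNReal.ofReal_one]

theorem gaugeNorm_nonneg (Φ : ℝ → ℝ) {Y : Type*} (f : Y → ℝ) : 0 ≤ gaugeNorm Φ f :=
  Real.sInf_nonneg fun _ hk => hk.1.le

theorem gaugeNorm_le {Φ : ℝ → ℝ} {Y : Type*} {f : Y → ℝ} {t : ℝ} (ht : 0 < t)
    (hf : modular Φ (t • f) ≤ 1) : gaugeNorm Φ f ≤ t⁻¹ := by
  refine csInf_le ⟨0, fun _ hk => hk.1.le⟩ ⟨inv_pos.2 ht, ?_⟩
  rwa [show (fun y => f y / t⁻¹) = t • f from by ext y; simp [mul_comm]]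

theorem IsStrictYoung.modular_smul_le_one_of_gaugeNorm_lt {Φ : ℝ → ℝ} (h : IsStrictYoung Φ)
    {Y : Type*} {f : Y → ℝ} (hf : f ∈ orliczSpace Φ Y) {t : ℝ} (ht : 0 < t)
    (hlt : gaugeNorm Φ f < t⁻¹) : modular Φ (t • f) ≤ 1 := by
  obtain ⟨k, ⟨hk, hk1⟩, hkt⟩ := exists_lt_of_csInf_lt (h.exists_modular_div_le hf) hlt
  refine le_trans (h.modular_mono fun y => ?_) hk1
  simp only [Pi.smul_apply, smul_eq_mul]
  rw [abs_mul, abs_div, abs_of_pos ht, abs_of_pos hk, div_eq_inv_mul]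
  gcongr
  rw [← inv_inv t]
  exact inv_anti₀ hk hkt.le

namespace IsStrictYoung

variable {Φ : ℝ → ℝ} (h : IsStrictYoung Φ) (hd : DeltaTwoZero Φ)
include h hd

theorem permRep_sub_mem_of_grad_mem {S : Finset G} {f : X → ℝ}
    (hf : grad S f ∈ orliczSpace Φ (S × X)) {s : G} (hs : s ∈ S) :
    permRep s f - f ∈ orliczSpace Φ X := by
  rw [h.mem_orliczSpace_iff hd] at *
  intro t
  have := hf t
  rw [modular_smul_grad] at this
  exact ENNReal.sum_ne_top.1 this s hs

theorem grad_mem_orlicz_iff {S : Finset G} (hS : Subgroup.closure (S : Set G) = ⊤) {f : X → ℝ} :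
    grad S f ∈ h.orlicz hd (S × X) ↔ f ∈ dirichletSpace Φ G X := by
  refine ⟨fun hf g => ?_, fun hf => ?_⟩
  · have hg : g ∈ Subgroup.closure (S : Set G) := hS ▸ Subgroup.mem_top g
    induction hg using Subgroup.closure_induction with
    | mem s hs => exact h.permRep_sub_mem_of_grad_mem hd hf hs
    | one =>
      have : permRep (1 : G) f - f = 0 := by ext x; simp [permRep]
      rw [this]
      exact (h.orlicz hd X).zero_mem
    | mul a b _ _ iha ihb =>
      have : permRep (a * b) f - f = permRep a (permRep b f - f) + (permRep a f - f) := by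
        ext x; simp [permRep, mul_smul]
      rw [this]
      exact (h.orlicz hd X).add_mem (permRep_mem_orliczSpace a ihb) iha
    | inv a _ ih =>
      have : permRep a⁻¹ f - f = -permRep a⁻¹ (permRep a f - f) := by
        ext x; simp [permRep]
      rw [this]
      exact (h.orlicz hd X).neg_mem (permRep_mem_orliczSpace a⁻¹ ih)
  · rw [h.mem_orlicz hd, h.mem_orliczSpace_iff hd]
    intro t
    rw [modular_smul_grad]
    exact ENNReal.sum_ne_top.2 fun s _ => (h.mem_orliczSpace_iff hd).1 (hf s) t

theorem grad_mem_orlicz_of_mem (S : Finset G) {v : X → ℝ} (hv : v ∈ orliczSpace Φ X) :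
    grad S v ∈ h.orlicz hd (S × X) := by
  rw [h.mem_orlicz hd, h.mem_orliczSpace_iff hd]
  intro t
  rw [modular_smul_grad]
  refine ENNReal.sum_ne_top.2 fun s _ => (h.mem_orliczSpace_iff hd).1 ?_ t
  exact (h.orlicz hd X).sub_mem (permRep_mem_orliczSpace s hv) hv

/-- The closure of the Orlicz space in the Dirichlet space, as a linear subspace. The approximation
is expressed through the modular of all dilates, which is equivalent to the norm. -/
def dirichletClosure (S : Finset G) : Submodule ℝ (X → ℝ) where
  carrier := {u | grad S u ∈ h.orlicz hd (S × X) ∧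
    ∀ t : ℝ, ∃ v ∈ h.orlicz hd X, modular Φ (t • grad S (u - v)) ≤ 1}
  zero_mem' := ⟨by simp, fun t => ⟨0, zero_mem _, by simp [h.modular_zero]⟩⟩
  add_mem' := by
    rintro u u' ⟨hu, hu2⟩ ⟨hu', hu2'⟩
    refine ⟨by rw [map_add]; exact add_mem hu hu', fun t => ?_⟩
    obtain ⟨v, hv, hle⟩ := hu2 (2 * t)
    obtain ⟨v', hv', hle'⟩ := hu2' (2 * t)
    refine ⟨v + v', add_mem hv hv', ?_⟩
    rw [add_sub_add_comm, map_add, smul_add]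
    exact h.modular_add_le_of_le (by rwa [smul_smul]) (by rwa [smul_smul])
  smul_mem' := by
    rintro c u ⟨hu, hu2⟩
    refine ⟨by rw [map_smul]; exact Submodule.smul_mem _ c hu, fun t => ?_⟩
    obtain ⟨v, hv, hle⟩ := hu2 (t * c)
    refine ⟨c • v, Submodule.smul_mem _ c hv, ?_⟩
    rwa [← smul_sub, map_smul, smul_smul]

theorem mem_dirichletClosure {S : Finset G} {u : X → ℝ} :
    u ∈ h.dirichletClosure hd S ↔ grad S u ∈ h.orlicz hd (S × X) ∧
      ∀ t : ℝ, ∃ v ∈ h.orlicz hd X, modular Φ (t • grad S (u - v)) ≤ 1 := Iff.rfl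

theorem mem_dirichletClosure_iff {S : Finset G} (hS : Subgroup.closure (S : Set G) = ⊤)
    {u : X → ℝ} : u ∈ h.dirichletClosure hd S ↔ u ∈ closureOrlicz Φ S := by
  rw [h.mem_dirichletClosure hd, h.grad_mem_orlicz_iff hd hS]
  refine and_congr_right fun hu => ⟨fun H ε hε => ?_, fun H t => ?_⟩
  · obtain ⟨v, hv, hle⟩ := H ((S.card + 1) / ε)
    refine ⟨v, hv, ?_⟩
    rw [modular_smul_grad] at hle
    have ht : 0 < ((S.card : ℝ) + 1) / ε := by positivity
    calc dirichletNorm Φ S (u - v) ≤ ∑ _s ∈ S, (((S.card : ℝ) + 1) / ε)⁻¹ :=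
          Finset.sum_le_sum fun s hs => gaugeNorm_le ht
            ((Finset.single_le_sum (f := fun s : G => modular Φ
              ((((S.card : ℝ) + 1) / ε) • (permRep s (u - v) - (u - v))))
              (fun _ _ => zero_le) hs).trans hle)
      _ = S.card * ε / (S.card + 1) := by
          rw [Finset.sum_const, nsmul_eq_mul, inv_div, mul_div_assoc]
      _ < ε := by
          rw [div_lt_iff₀ (by positivity)]
          nlinarith
  · -- The factor `card S + 1` leaves room for the sum of the modulars over `S`.
    set T : ℝ := |t| + 1
    have hT : 0 < T := by positivity
    set R : ℝ := S.card + 1 with hR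
    have hR0 : 0 < R := by positivity
    have hR1 : 1 ≤ R := by simp [hR]
    obtain ⟨v, hv, hlt⟩ := H (R * T)⁻¹ (by positivity)
    refine ⟨v, hv, ?_⟩
    have hD : grad S (u - v) ∈ h.orlicz hd (S × X) := by
      rw [map_sub]
      exact sub_mem ((h.grad_mem_orlicz_iff hd hS).2 hu) (h.grad_mem_orlicz_of_mem hd S hv)
    have hone : ∀ s ∈ S, modular Φ (T • (permRep s (u - v) - (u - v))) ≤
        ENNReal.ofReal R⁻¹ := by
      intro s hs
      have h1 := h.modular_smul_le_one_of_gaugeNorm_lt (h.permRep_sub_mem_of_grad_mem hd hD hs)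
        (by positivity : 0 < R * T)
        ((Finset.single_le_sum (f := fun s : G => gaugeNorm Φ (permRep s (u - v) - (u - v)))
          (fun _ _ => gaugeNorm_nonneg _ _) hs).trans_lt hlt)
      have h2 := h.modular_smul_le (inv_nonneg.2 hR0.le) (inv_le_one_of_one_le₀ hR1)
        ((R * T) • (permRep s (u - v) - (u - v)))
      rw [smul_smul, inv_mul_cancel_left₀ hR0.ne'] at h2
      exact h2.trans (mul_le_of_le_one_right' h1)
    calc modular Φ (t • grad S (u - v)) ≤ modular Φ (T • grad S (u - v)) :=
          h.modular_mono fun p => by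
            simp only [Pi.smul_apply, smul_eq_mul, abs_mul]
            exact mul_le_mul_of_nonneg_right (by rw [abs_of_pos hT]; simp [T]) (abs_nonneg _)
      _ = ∑ s ∈ S, modular Φ (T • (permRep s (u - v) - (u - v))) := modular_smul_grad _ _ _ _
      _ ≤ ∑ s ∈ S, ENNReal.ofReal R⁻¹ := Finset.sum_le_sum hone
      _ = ENNReal.ofReal (S.card * R⁻¹) := by
          rw [Finset.sum_const, nsmul_eq_mul, ENNReal.ofReal_mul (by positivity),
            ENNReal.ofReal_natCast]
      _ ≤ 1 := by
          rw [ENNReal.ofReal_le_one, ← div_eq_mul_inv, div_le_one hR0]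
          simp [hR]

theorem orlicz_le_dirichletClosure (S : Finset G) :
    h.orlicz hd X ≤ h.dirichletClosure hd S := fun v hv =>
  ⟨h.grad_mem_orlicz_of_mem hd S hv, fun t => ⟨v, hv, by simp [h.modular_zero]⟩⟩

theorem mem_dirichletClosure_of_grad_eq_zero {S : Finset G} {c : X → ℝ} (hc : grad S c = 0) :
    c ∈ h.dirichletClosure hd S :=
  ⟨by simp [hc], fun t => ⟨0, zero_mem _, by simp [hc, h.modular_zero]⟩⟩

/-- The closure of the Orlicz space is closed. -/
theorem mem_dirichletClosure_of_approx {S : Finset G} {u : X → ℝ}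
    (hu : grad S u ∈ h.orlicz hd (S × X))
    (H : ∀ t : ℝ, ∃ w ∈ h.dirichletClosure hd S, modular Φ (t • grad S (u - w)) ≤ 1) :
    u ∈ h.dirichletClosure hd S := by
  refine ⟨hu, fun t => ?_⟩
  obtain ⟨w, ⟨-, hw⟩, hle⟩ := H (2 * t)
  obtain ⟨v, hv, hle'⟩ := hw (2 * t)
  refine ⟨v, hv, ?_⟩
  rw [← sub_add_sub_cancel u w v, map_add, smul_add]
  exact h.modular_add_le_of_le (by rwa [smul_smul]) (by rwa [smul_smul])

/-- Elements of the closure are limits of finitely supported functions. -/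
theorem exists_finite_support_approx {S : Finset G} {u : X → ℝ}
    (hu : u ∈ h.dirichletClosure hd S) (t : ℝ) :
    ∃ v : X → ℝ, v.support.Finite ∧ modular Φ (t • grad S (u - v)) ≤ 1 := by
  obtain ⟨w, hw, hle⟩ := hu.2 (2 * t)
  obtain ⟨F, hF⟩ := h.exists_finite_support_modular_sub_le
    ((h.mem_orliczSpace_iff hd).1 hw (2 * (2 * t))) (ε := ((S.card : ℝ≥0∞) + 1)⁻¹) (by simp)
  refine ⟨(F : Set X).indicator w, F.finite_toSet.subset Set.support_indicator_subset, ?_⟩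
  rw [← sub_add_sub_cancel u w, map_add, smul_add]
  refine h.modular_add_le_of_le (by rwa [smul_smul]) ?_
  rw [smul_smul, modular_smul_grad]
  have hone : ∀ s ∈ S, modular Φ ((2 * t) • (permRep s (w - (F : Set X).indicator w) -
      (w - (F : Set X).indicator w))) ≤ ((S.card : ℝ≥0∞) + 1)⁻¹ := by
    intro s _
    have hind : (F : Set X).indicator ((2 * (2 * t)) • w) =
        (2 * (2 * t)) • (F : Set X).indicator w := by
      ext x
      by_cases hx : x ∈ F <;> simp [hx]
    have hF' : modular Φ ((2 : ℝ) • (2 * t) • (w - (F : Set X).indicator w)) ≤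
        ((S.card : ℝ≥0∞) + 1)⁻¹ := by
      rwa [smul_smul, smul_sub, ← hind]
    rw [smul_sub, sub_eq_add_neg]
    refine h.modular_add_le_of_le ?_ ?_
    · exact (modular_permRep Φ s ((2 : ℝ) • (2 * t) • (w - (F : Set X).indicator w))).trans_le hF'
    · rw [smul_neg, h.modular_neg]
      exact hF'
  calc _ ≤ ∑ _s ∈ S, ((S.card : ℝ≥0∞) + 1)⁻¹ := Finset.sum_le_sum hone
    _ = S.card * ((S.card : ℝ≥0∞) + 1)⁻¹ := by rw [Finset.sum_const, nsmul_eq_mul]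
    _ ≤ (S.card + 1) * ((S.card : ℝ≥0∞) + 1)⁻¹ := by gcongr; exact le_self_add
    _ ≤ 1 := ENNReal.mul_inv_le_one _

end IsStrictYoung

/-! ### Existence of an energy minimizer -/

/-- Any function agrees, up to a function constant on orbits, with one that vanishes at a chosen
representative of each orbit. -/
theorem exists_invariant_normalization (G : Type*) {X : Type*} [Group G]
    [MulAction G X] (f : X → ℝ) : ∃ c : X → ℝ, (∀ (g : G) x, c (g • x) = c x) ∧
      ∀ x, (f - c) (Quotient.mk (MulAction.orbitRel G X) x).out = 0 := by
  refine ⟨fun x => f (Quotient.mk (MulAction.orbitRel G X) x).out, fun g x => ?_, fun x => ?_⟩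
  · have : Quotient.mk (MulAction.orbitRel G X) (g • x) = Quotient.mk (MulAction.orbitRel G X) x :=
      Quotient.sound (s := MulAction.orbitRel G X) ⟨g, rfl⟩
    simp only [this]
  · simp only [Pi.sub_apply, Quotient.out_eq, sub_self]

namespace IsStrictYoung

variable {Φ : ℝ → ℝ}

/-- The direct method: on `f + closure(ℓ^Φ)` the energy `modular Φ (grad S ·)` attains its minimum.
A minimizing sequence, normalized on each orbit, is bounded pointwise and has a pointwise limit
along an ultrafilter; Fatou's lemma bounds the energy of the limit, and by the Banach–Saks property
the limit stays in the affine subspace. -/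
theorem exists_energy_minimizer (h : IsStrictYoung Φ) (hd : DeltaTwoZero Φ) (hn : NablaTwoZero Φ)
    {S : Finset G} (hS : Subgroup.closure (S : Set G) = ⊤) {f : X → ℝ}
    (hf : grad S f ∈ h.orlicz hd (S × X)) :
    ∃ u ∈ h.dirichletClosure hd S, ∀ w ∈ h.dirichletClosure hd S,
      modular Φ (grad S (f - u)) ≤ modular Φ (grad S (f - u + w)) := by
  set C := h.dirichletClosure (X := X) hd S
  set m : ℝ≥0∞ := ⨅ u : C, modular Φ (grad S (f - (u : X → ℝ)))
  have hm_le : ∀ u ∈ C, m ≤ modular Φ (grad S (f - u)) := fun u hu =>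
    iInf_le (fun u : C => modular Φ (grad S (f - (u : X → ℝ)))) ⟨u, hu⟩
  have hm_fin : m ≠ ∞ := by
    refine ne_top_of_le_ne_top ?_ (hm_le 0 C.zero_mem)
    simpa using (h.mem_orliczSpace_iff hd).1 hf 1
  have hseq : ∀ n : ℕ, ∃ u ∈ C, (∀ x, (f - u) (Quotient.mk (MulAction.orbitRel G X) x).out = 0) ∧
      modular Φ (grad S (f - u)) ≤ m + ((n : ℝ≥0∞) + 1)⁻¹ := by
    intro n
    have hlt : m < m + ((n : ℝ≥0∞) + 1)⁻¹ := ENNReal.lt_add_right hm_fin (by simp)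
    obtain ⟨⟨u, hu⟩, hlt⟩ := iInf_lt_iff.1 hlt
    obtain ⟨c, hc, hc0⟩ := exists_invariant_normalization G (f - u)
    have hgc := grad_eq_zero_of_invariant (S := S) hc
    refine ⟨u + c, C.add_mem hu (h.mem_dirichletClosure_of_grad_eq_zero hd hgc), ?_, ?_⟩
    · rwa [← sub_sub]
    · rw [← sub_sub, map_sub, hgc, sub_zero]
      exact hlt.le
  choose u huC hu0 hum using hseq
  have hm1 : m + 1 ≠ ∞ := by simp [hm_fin]
  have hbound : ∀ n, modular Φ (grad S (f - u n)) ≤ m + 1 := fun n =>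
    (hum n).trans (by gcongr; simp)
  have hpt : ∀ x, ∃ B, ∀ n, |(f - u n) x| ≤ B := by
    intro x
    obtain ⟨g, hg⟩ : ∃ g : G, g • (Quotient.mk (MulAction.orbitRel G X) x).out = x :=
      (MulAction.orbitRel G X).symm (Quotient.mk_out (s := MulAction.orbitRel G X) x)
    obtain ⟨B, hB⟩ := exists_abs_sub_le_of_grad hS (f := fun n => f - u n)
      (fun n => h.abs_le_of_modular_le hm1 (hbound n)) g
      (Quotient.mk (MulAction.orbitRel G X) x).out
    refine ⟨B, fun n => ?_⟩
    have := hB n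
    rwa [hu0, sub_zero, hg] at this
  have hlim : ∀ x, ∃ a, Tendsto (fun n => (f - u n) x) (hyperfilter ℕ : Filter ℕ) (𝓝 a) := by
    intro x
    obtain ⟨B, hB⟩ := hpt x
    obtain ⟨a, -, ha⟩ := (isCompact_Icc (a := -B) (b := B)).ultrafilter_le_nhds
      ((hyperfilter ℕ).map fun n => (f - u n) x)
      (le_principal_iff.2 (show ∀ᶠ n in (hyperfilter ℕ : Filter ℕ),
        (f - u n) x ∈ Set.Icc (-B) B from Eventually.of_forall fun n => abs_le.1 (hB n)))
    exact ⟨a, ha⟩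
  choose k hk using hlim
  have hgrad : ∀ p, Tendsto (fun n => grad S (f - u n) p) (hyperfilter ℕ : Filter ℕ)
      (𝓝 (grad S k p)) := fun p => (hk _).sub (hk _)
  have hm0 : Tendsto (fun n : ℕ => m + ((n : ℝ≥0∞) + 1)⁻¹) (hyperfilter ℕ : Filter ℕ) (𝓝 m) := by
    have h1 : Tendsto (fun n : ℕ => ((n : ℝ≥0∞) + 1)⁻¹) atTop (𝓝 0) := by
      simpa using (tendsto_add_atTop_iff_nat 1).2 ENNReal.tendsto_inv_nat_nhds_zero
    simpa using (h1.const_add m).mono_left Nat.hyperfilter_le_atTop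
  have hkm : modular Φ (grad S k) ≤ m := h.modular_le_of_tendsto hgrad hm0 hum
  have hk_mem : grad S k ∈ h.orlicz hd (S × X) :=
    mem_orliczSpace_of_modular (ne_top_of_le_ne_top hm_fin hkm)
  have hmem : f - k ∈ C := by
    refine h.mem_dirichletClosure_of_approx hd (by rw [map_sub]; exact sub_mem hf hk_mem) ?_
    intro t
    obtain ⟨K, hK, HK⟩ := h.exists_modular_smul_le (Y := S × X) hd (2 * t) hm1
    obtain ⟨N, j, hN, hle⟩ := h.exists_modular_average_le hd hn (l := (hyperfilter ℕ : Filter ℕ))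
      (a := fun n => t • (grad S (f - u n) - grad S k)) (M := K)
      (fun p => by simpa using (((hgrad p).sub_const (grad S k p))).const_mul t) hK
      (fun n => by
        rw [smul_sub, sub_eq_add_neg]
        refine h.modular_add_le_of_le ?_ ?_
        · rw [smul_smul]
          exact HK _ (hbound n)
        · rw [smul_neg, h.modular_neg, smul_smul]
          exact HK _ (hkm.trans le_self_add))
    have hNr : (N : ℝ) ≠ 0 := by exact_mod_cast hN.ne'
    refine ⟨(N : ℝ)⁻¹ • ∑ i, u (j i), C.smul_mem _ (C.sum_mem fun i _ => huC _), ?_⟩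
    have hav : f - k - (N : ℝ)⁻¹ • ∑ i, u (j i) = (N : ℝ)⁻¹ • ∑ i, (f - u (j i) - k) := by
      simp only [Finset.sum_sub_distrib, smul_sub, Finset.sum_const, Finset.card_univ,
        Fintype.card_fin, ← Nat.cast_smul_eq_nsmul ℝ, inv_smul_smul₀ hNr]
      abel
    rw [hav, map_smul, smul_comm, map_sum, Finset.smul_sum]
    simpa only [map_sub] using hle
  refine ⟨f - k, hmem, fun w hw => ?_⟩
  rw [sub_sub_cancel]
  refine hkm.trans ((hm_le (f - k - w) (C.sub_mem hmem hw)).trans (le_of_eq ?_))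
  rw [← sub_add, sub_sub_cancel]

/-! ### Minimizers and harmonic functions -/

theorem deriv_neg (h : IsStrictYoung Φ) (x : ℝ) : deriv Φ (-x) = -deriv Φ x := by
  have h1 : (fun y => Φ (-y)) = Φ := funext h.even
  have h2 := deriv_comp_neg Φ x
  rw [h1] at h2
  linarith

theorem deriv_mul_le (h : IsStrictYoung Φ) (hdiff : Differentiable ℝ Φ) (x y : ℝ) :
    deriv Φ x * y ≤ Φ (x + y) - Φ x := by
  rcases lt_trichotomy y 0 with hy | rfl | hy
  · have := h.strictConvex.convexOn.slope_le_deriv (Set.mem_univ (x + y)) (Set.mem_univ x)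
      (by linarith) (hdiff x)
    rw [slope_def_field, div_le_iff₀ (by linarith)] at this
    linarith
  · simp
  · have := h.strictConvex.convexOn.deriv_le_slope (Set.mem_univ x) (Set.mem_univ (x + y))
      (by linarith) (hdiff x)
    rw [slope_def_field, le_div_iff₀ (by linarith)] at this
    linarith

/-- Green's formula: the `Φ`-Laplacian is, up to the factor `-2`, the gradient of the energy. -/
theorem tsum_deriv_grad_mul_grad (h : IsStrictYoung Φ) {S : Finset G}
    (hS : ∀ s ∈ S, s⁻¹ ∈ S) (k : X → ℝ) {v : X → ℝ} (hv : v.support.Finite) :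
    ∑' p, deriv Φ (grad S k p) * grad S v p = -2 * ∑' x, phiLaplacian Φ S k x * v x := by
  set α : G → X → ℝ := fun s x => deriv Φ (k (s⁻¹ • x) - k x) with hα
  have hα_inv : ∀ s x, α s (s • x) = -α s⁻¹ x := by
    intro s x
    simp only [hα, inv_smul_smul, inv_inv]
    rw [← h.deriv_neg, neg_sub]
  have hsum : ∀ β : X → ℝ, Summable fun x => β x * v x := fun β =>
    summable_of_hasFiniteSupport (hv.subset (Function.support_mul_subset_right _ _))
  have hsum' : ∀ (s : G) (β : X → ℝ), Summable fun x => β x * v (s⁻¹ • x) := fun s β => by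
    have := hsum fun x => β (s • x)
    rw [← (MulAction.toPerm s⁻¹ : Equiv.Perm X).summable_iff] at this
    simpa [Function.comp_def] using this
  have hinner : ∀ s : G, ∑' x, α s x * (v (s⁻¹ • x) - v x) =
      -(∑' x, α s⁻¹ x * v x) - ∑' x, α s x * v x := by
    intro s
    simp only [mul_sub]
    rw [(hsum' s _).tsum_sub (hsum _)]
    congr 1
    rw [← (MulAction.toPerm s : Equiv.Perm X).tsum_eq, ← tsum_neg]
    refine tsum_congr fun x => ?_
    rw [MulAction.toPerm_apply, inv_smul_smul, hα_inv, neg_mul]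
  have hprod : ∑' p, deriv Φ (grad S k p) * grad S v p =
      ∑ s : S, ∑' x, α s x * (v ((s : G)⁻¹ • x) - v x) := by
    rw [← tsum_fintype (L := .unconditional _)]
    exact (summable_of_hasFiniteSupport ((finite_support_grad S hv).subset
      (Function.support_mul_subset_right _ _))).tsum_prod
  have hinv : ∑ s ∈ S, ∑' x, α s⁻¹ x * v x = ∑ s ∈ S, ∑' x, α s x * v x :=
    Finset.sum_nbij' (fun s => s⁻¹) (fun s => s⁻¹) hS hS (by simp) (by simp) (by simp)
  rw [hprod, Finset.sum_coe_sort S fun s => ∑' x, α s x * (v (s⁻¹ • x) - v x)]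
  simp only [hinner]
  rw [Finset.sum_sub_distrib, Finset.sum_neg_distrib, hinv,
    ← Summable.tsum_finsetSum fun s _ => hsum _]
  have : ∀ x, ∑ s ∈ S, α s x * v x = phiLaplacian Φ S k x * v x := fun x => by
    rw [phiLaplacian, Finset.sum_mul]
  simp only [this]
  ring

section Perturbation

variable {Y : Type*}

theorem modular_eq_sum_add (h : IsStrictYoung Φ) (F : Finset Y) (a : Y → ℝ) :
    modular Φ a = ENNReal.ofReal (∑ y ∈ F, Φ (a y)) +
      ∑' y : {y // y ∉ F}, ENNReal.ofReal (Φ (a y)) := by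
  rw [ENNReal.ofReal_sum_of_nonneg fun y _ => h.nonneg _]
  exact (ENNReal.sum_add_tsum_compl F _).symm

/-- Modulars of functions that differ on a finite set only are compared on that set. -/
theorem modular_le_modular_add_iff (h : IsStrictYoung Φ) {a b : Y → ℝ} {F : Finset Y}
    (ha : modular Φ a ≠ ∞) (hb : ∀ y ∉ F, b y = 0) :
    modular Φ a ≤ modular Φ (a + b) ↔ ∑ y ∈ F, Φ (a y) ≤ ∑ y ∈ F, Φ (a y + b y) := by
  have htail : ∑' y : {y // y ∉ F}, ENNReal.ofReal (Φ ((a + b) y)) =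
      ∑' y : {y // y ∉ F}, ENNReal.ofReal (Φ (a y)) :=
    tsum_congr fun y => by rw [Pi.add_apply, hb y y.2, add_zero]
  have hfin : ∑' y : {y // y ∉ F}, ENNReal.ofReal (Φ (a y)) ≠ ∞ := by
    rw [h.modular_eq_sum_add F] at ha
    exact (ENNReal.add_ne_top.1 ha).2
  rw [h.modular_eq_sum_add F a, h.modular_eq_sum_add F (a + b), htail,
    ENNReal.add_le_add_iff_right hfin,
    ENNReal.ofReal_le_ofReal_iff (Finset.sum_nonneg fun y _ => h.nonneg _)]
  rfl

theorem tsum_deriv_mul_eq_zero_of_forall_le (h : IsStrictYoung Φ) (hdiff : Differentiable ℝ Φ)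
    {a b : Y → ℝ} (ha : modular Φ a ≠ ∞) (hb : b.support.Finite)
    (hmin : ∀ t : ℝ, modular Φ a ≤ modular Φ (a + t • b)) :
    ∑' y, deriv Φ (a y) * b y = 0 := by
  have hb0 : ∀ y ∉ hb.toFinset, b y = 0 := fun y hy => by simpa using hy
  rw [tsum_eq_sum fun y hy => by rw [hb0 y hy, mul_zero]]
  have hderiv : HasDerivAt (fun t : ℝ => ∑ y ∈ hb.toFinset, Φ (a y + t * b y))
      (∑ y ∈ hb.toFinset, deriv Φ (a y) * b y) 0 := by
    refine HasDerivAt.fun_sum fun y _ => ?_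
    have h1 : HasDerivAt (fun t : ℝ => a y + t * b y) (b y) 0 := by
      simpa using ((hasDerivAt_id (0 : ℝ)).mul_const (b y)).const_add (a y)
    have h2 : HasDerivAt Φ (deriv Φ (a y)) (a y + 0 * b y) := by
      simpa using (hdiff (a y)).hasDerivAt
    exact h2.comp (0 : ℝ) h1
  refine IsLocalMin.hasDerivAt_eq_zero (Eventually.of_forall fun t => ?_) hderiv
  have := (h.modular_le_modular_add_iff (b := t • b) (F := hb.toFinset) ha
    fun y hy => by simp [hb0 y hy]).1 (hmin t)
  simpa using this

theorem modular_le_of_tsum_deriv_mul_eq_zero (h : IsStrictYoung Φ) (hdiff : Differentiable ℝ Φ)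
    {a b : Y → ℝ} (ha : modular Φ a ≠ ∞) (hb : b.support.Finite)
    (hcrit : ∑' y, deriv Φ (a y) * b y = 0) : modular Φ a ≤ modular Φ (a + b) := by
  have hb0 : ∀ y ∉ hb.toFinset, b y = 0 := fun y hy => by simpa using hy
  rw [h.modular_le_modular_add_iff ha hb0]
  rw [tsum_eq_sum fun y hy => by rw [hb0 y hy, mul_zero]] at hcrit
  have := Finset.sum_le_sum fun y (_ : y ∈ hb.toFinset) => h.deriv_mul_le hdiff (a y) (b y)
  rw [hcrit, Finset.sum_sub_distrib] at this
  linarith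

/-- Strict convexity of the modular where it is finite. -/
theorem eq_of_modular_midpoint (h : IsStrictYoung Φ) {a b : Y → ℝ} (ha : modular Φ a ≠ ∞)
    (hba : modular Φ b ≤ modular Φ a)
    (hmid : modular Φ a ≤ modular Φ ((2⁻¹ : ℝ) • a + (2⁻¹ : ℝ) • b)) : a = b := by
  by_contra hne
  obtain ⟨y, hy⟩ := Function.ne_iff.1 hne
  refine absurd hmid (not_le.2 ?_)
  have hhalf : (0 : ℝ) < 2⁻¹ := by norm_num
  have hle : ∀ y, Φ (2⁻¹ * a y + 2⁻¹ * b y) ≤ 2⁻¹ * Φ (a y) + 2⁻¹ * Φ (b y) := fun y =>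
    h.convex_comb hhalf.le hhalf.le (by norm_num) _ _
  have hlt : Φ (2⁻¹ * a y + 2⁻¹ * b y) < 2⁻¹ * Φ (a y) + 2⁻¹ * Φ (b y) :=
    h.strictConvex.2 (Set.mem_univ _) (Set.mem_univ _) hy hhalf hhalf (by norm_num)
  have hsum : ∑' y, ENNReal.ofReal (2⁻¹ * Φ (a y) + 2⁻¹ * Φ (b y)) ≤ modular Φ a := by
    calc _ = 2⁻¹ * modular Φ a + 2⁻¹ * modular Φ b := by
          unfold modular
          rw [← ENNReal.tsum_mul_left, ← ENNReal.tsum_mul_left, ← ENNReal.tsum_add]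
          refine tsum_congr fun y => ?_
          rw [ENNReal.ofReal_add (mul_nonneg hhalf.le (h.nonneg _))
            (mul_nonneg hhalf.le (h.nonneg _)), ENNReal.ofReal_mul hhalf.le,
            ENNReal.ofReal_mul hhalf.le, ENNReal.ofReal_inv_of_pos two_pos, ENNReal.ofReal_ofNat]
      _ ≤ 2⁻¹ * modular Φ a + 2⁻¹ * modular Φ a := by gcongr
      _ = modular Φ a := by rw [← add_mul, ENNReal.inv_two_add_inv_two, one_mul]
  refine lt_of_lt_of_le ?_ hsum
  refine ENNReal.tsum_lt_tsum (i := y) ?_ (fun y => ENNReal.ofReal_le_ofReal (hle y)) ?_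
  · refine ne_top_of_le_ne_top ha (le_trans ?_ hsum)
    exact ENNReal.tsum_le_tsum fun y => ENNReal.ofReal_le_ofReal (hle y)
  · exact (ENNReal.ofReal_lt_ofReal_iff ((h.nonneg _).trans_lt hlt)).2 hlt

end Perturbation

/-- The Euler–Lagrange equation, obtained by perturbing at single points. -/
theorem phiLaplacian_eq_zero_of_minimizer (h : IsStrictYoung Φ) (hdiff : Differentiable ℝ Φ)
    (hd : DeltaTwoZero Φ) {S : Finset G} (hS : ∀ s ∈ S, s⁻¹ ∈ S) {k : X → ℝ}
    (hk : modular Φ (grad S k) ≠ ∞)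
    (hmin : ∀ w ∈ h.dirichletClosure hd S, modular Φ (grad S k) ≤ modular Φ (grad S (k + w)))
    (x : X) : phiLaplacian Φ S k x = 0 := by
  classical
  have hsupp : (Pi.single x 1 : X → ℝ).support.Finite :=
    (Set.finite_singleton x).subset Pi.support_single_subset
  have hmem : Pi.single x 1 ∈ h.dirichletClosure hd S :=
    h.orlicz_le_dirichletClosure hd S
      (mem_orliczSpace_of_modular (h.modular_ne_top_of_finite_support hsupp))
  have := h.tsum_deriv_mul_eq_zero_of_forall_le hdiff hk (finite_support_grad S hsupp)
    (fun t => by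
      rw [← map_smul, ← map_add]
      exact hmin _ (Submodule.smul_mem _ t hmem))
  rw [h.tsum_deriv_grad_mul_grad hS k hsupp, tsum_eq_single x fun y hy => by simp [hy]] at this
  simpa using this

/-- A `Φ`-harmonic function has minimal energy among its perturbations by elements of the closure
of `ℓ^Φ`. For finitely supported perturbations this is Green's formula and convexity. For general
`w`, let `v` be a finitely supported approximation; then `k + (1 - θ) v` is a convex combination of
`k + w`, with weight `1 - θ`, and of a function of bounded energy. -/
theorem energy_le_of_harmonic (h : IsStrictYoung Φ) (hdiff : Differentiable ℝ Φ)
    (hd : DeltaTwoZero Φ) {S : Finset G} (hS : ∀ s ∈ S, s⁻¹ ∈ S) {k : X → ℝ}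
    (hk : grad S k ∈ h.orlicz hd (S × X)) (hharm : ∀ x, phiLaplacian Φ S k x = 0) {w : X → ℝ}
    (hw : w ∈ h.dirichletClosure hd S) :
    modular Φ (grad S k) ≤ modular Φ (grad S (k + w)) := by
  rw [h.mem_orlicz hd, h.mem_orliczSpace_iff hd] at hk
  have hk1 : modular Φ (grad S k) ≠ ∞ := by simpa using hk 1
  -- Finitely supported perturbations do not decrease the energy.
  have hfinite : ∀ v : X → ℝ, v.support.Finite →
      modular Φ (grad S k) ≤ modular Φ (grad S (k + v)) := by
    intro v hv
    rw [map_add]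
    refine h.modular_le_of_tsum_deriv_mul_eq_zero hdiff hk1 (finite_support_grad S hv) ?_
    rw [h.tsum_deriv_grad_mul_grad hS k hv]
    simp [hharm]
  set K := modular Φ ((2 : ℝ) • grad S k) + 1
  have hK : K ≠ ∞ := by simp [K, hk 2]
  have hθ : ∀ θ : ℝ, 0 < θ → θ ≤ 1 →
      modular Φ (grad S k) ≤ modular Φ (grad S (k + w)) + ENNReal.ofReal θ * K := by
    intro θ hθ hθ1
    obtain ⟨v, hv, hle⟩ := h.exists_finite_support_approx hd hw (-(2 * ((1 - θ) / θ)))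
    have hdecomp : grad S (k + (1 - θ) • v) = (1 - θ) • grad S (k + w) +
        θ • (grad S k + (-((1 - θ) / θ)) • grad S (w - v)) := by
      simp only [← map_smul, ← map_add]
      congr 1
      ext x
      simp only [Pi.add_apply, Pi.smul_apply, Pi.sub_apply, smul_eq_mul]
      field_simp
      ring
    have hrem : modular Φ (grad S k + (-((1 - θ) / θ)) • grad S (w - v)) ≤ K := by
      refine (h.modular_add_le _ _).trans ?_
      have h4 : (2⁻¹ : ℝ≥0∞) ≤ 1 := by simp
      rw [smul_smul, mul_neg]
      calc _ ≤ 1 * modular Φ ((2 : ℝ) • grad S k) + 1 * 1 := by gcongr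
        _ = K := by simp [K]
    calc modular Φ (grad S k) ≤ modular Φ (grad S (k + (1 - θ) • v)) :=
          hfinite _ (hv.subset (Function.support_const_smul_subset _ _))
      _ ≤ ENNReal.ofReal (1 - θ) * modular Φ (grad S (k + w)) + ENNReal.ofReal θ * K := by
          rw [hdecomp]
          refine (h.modular_convex (sub_nonneg.2 hθ1) hθ.le (by ring) _ _).trans ?_
          gcongr
      _ ≤ 1 * modular Φ (grad S (k + w)) + ENNReal.ofReal θ * K := by
          gcongr
          rw [ENNReal.ofReal_le_one]
          linarith
      _ = _ := by rw [one_mul]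
  have hlim : Tendsto (fun n : ℕ => modular Φ (grad S (k + w)) +
      ENNReal.ofReal (1 / ((n : ℝ) + 1)) * K) atTop (𝓝 (modular Φ (grad S (k + w)))) := by
    have h1 := ENNReal.tendsto_ofReal (tendsto_one_div_add_atTop_nhds_zero_nat (𝕜 := ℝ))
    have h2 := ENNReal.Tendsto.mul_const h1 (Or.inr hK)
    simpa using h2.const_add (modular Φ (grad S (k + w)))
  refine ge_of_tendsto' hlim fun n => hθ _ (by positivity) ?_
  rw [div_le_one (by positivity)]
  simp

/-- Two `Φ`-harmonic functions that differ by an element of the closure of `ℓ^Φ` have the same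
gradient: both minimize a strictly convex energy over the same affine subspace. -/
theorem grad_eq_zero_of_harmonic (h : IsStrictYoung Φ) (hdiff : Differentiable ℝ Φ)
    (hd : DeltaTwoZero Φ) {S : Finset G} (hS : ∀ s ∈ S, s⁻¹ ∈ S) {k w : X → ℝ}
    (hk : grad S k ∈ h.orlicz hd (S × X)) (hharm : ∀ x, phiLaplacian Φ S k x = 0)
    (hharm' : ∀ x, phiLaplacian Φ S (k + w) x = 0) (hw : w ∈ h.dirichletClosure hd S) :
    grad S w = 0 := by
  have hkw : grad S (k + w) ∈ h.orlicz hd (S × X) := by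
    rw [map_add]
    exact add_mem hk hw.1
  have h1 := h.energy_le_of_harmonic hdiff hd hS hkw hharm' (neg_mem hw)
  rw [add_neg_cancel_right] at h1
  have h2 := h.energy_le_of_harmonic hdiff hd hS hk hharm (Submodule.smul_mem _ (2⁻¹ : ℝ) hw)
  have hmid : grad S (k + (2⁻¹ : ℝ) • w) =
      (2⁻¹ : ℝ) • grad S k + (2⁻¹ : ℝ) • grad S (k + w) := by
    rw [← map_smul, ← map_smul, ← map_add]
    congr 1
    ext x
    simp only [Pi.add_apply, Pi.smul_apply, smul_eq_mul]
    ring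
  rw [hmid] at h2
  have := h.eq_of_modular_midpoint (by simpa using (h.mem_orliczSpace_iff hd).1 hk 1) h1 h2
  rwa [map_add, left_eq_add] at this

end IsStrictYoung

theorem phiLaplacian_sub_of_invariant (Φ : ℝ → ℝ) (S : Finset G) (k : X → ℝ) {c : X → ℝ}
    (hc : ∀ (g : G) x, c (g • x) = c x) :
    phiLaplacian Φ S (k - c) = phiLaplacian Φ S k := by
  ext x
  simp [phiLaplacian, hc]

end PhiHarmonic

theorem theorem3p6 {G X : Type*} [Group G] [MulAction G X] [Countable X]
    (S : Finset G) (hS_gen : Subgroup.closure (S : Set G) = ⊤)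
    (hS_symm : ∀ s ∈ S, s⁻¹ ∈ S)
    (Φ : ℝ → ℝ) (hΦ : PhiHarmonic.IsNFunction Φ) (hΦ_C1 : ContDiff ℝ 1 Φ)
    (hΦ_conv : StrictConvexOn ℝ Set.univ Φ)
    (hΦ_delta : PhiHarmonic.DeltaTwoZero Φ) (hΦ_nabla : PhiHarmonic.NablaTwoZero Φ)
    (f : X → ℝ) (hf : f ∈ PhiHarmonic.dirichletSpace Φ G X) :
    ∃ u ∈ PhiHarmonic.closureOrlicz (X := X) Φ S,
      ∃ h ∈ PhiHarmonic.harmonicDirichlet (X := X) Φ S,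
        f = u + h ∧
        ∀ u' h' : X → ℝ,
          (u' ∈ PhiHarmonic.closureOrlicz Φ S ∧ h' ∈ PhiHarmonic.harmonicDirichlet Φ S ∧
              f = u' + h') ↔
            ∃ c ∈ PhiHarmonic.dirichletInvariants Φ G X, u' = u + c ∧ h' = h - c := by
  have hY := hΦ.isStrictYoung hΦ_conv
  have hdiff : Differentiable ℝ Φ := hΦ_C1.differentiable one_ne_zero
  have hD : ∀ {g : X → ℝ}, PhiHarmonic.grad S g ∈ hY.orlicz hΦ_delta (S × X) ↔
      g ∈ PhiHarmonic.dirichletSpace Φ G X := hY.grad_mem_orlicz_iff hΦ_delta hS_gen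
  have hC : ∀ {g : X → ℝ}, g ∈ hY.dirichletClosure hΦ_delta S ↔
      g ∈ PhiHarmonic.closureOrlicz Φ S := hY.mem_dirichletClosure_iff hΦ_delta hS_gen
  obtain ⟨u, hu, hmin⟩ := hY.exists_energy_minimizer hΦ_delta hΦ_nabla hS_gen (hD.2 hf)
  have hh : PhiHarmonic.grad S (f - u) ∈ hY.orlicz hΦ_delta (S × X) := by
    rw [map_sub]
    exact sub_mem (hD.2 hf) hu.1
  have hharm : ∀ x, PhiHarmonic.phiLaplacian Φ S (f - u) x = 0 :=
    hY.phiLaplacian_eq_zero_of_minimizer hdiff hΦ_delta hS_symm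
      (by simpa using (hY.mem_orliczSpace_iff hΦ_delta).1 hh 1) hmin
  refine ⟨u, hC.1 hu, f - u, ⟨hD.1 hh, hharm⟩, (add_sub_cancel u f).symm, fun u' h' => ⟨?_, ?_⟩⟩
  · rintro ⟨hu', ⟨-, hharm'⟩, hfu⟩
    obtain rfl : h' = f - u' := by rw [hfu, add_sub_cancel_left]
    have hw : u - u' ∈ hY.dirichletClosure hΦ_delta S := sub_mem hu (hC.2 hu')
    have hgrad := hY.grad_eq_zero_of_harmonic hdiff hΦ_delta hS_symm hh hharm
      (by rwa [sub_add_sub_cancel]) hw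
    have hgrad' : PhiHarmonic.grad S (u' - u) = 0 := by
      rw [← neg_sub, map_neg, hgrad, neg_zero]
    refine ⟨u' - u, ⟨hD.1 ?_, PhiHarmonic.apply_smul_eq_of_grad_eq_zero hS_gen hgrad'⟩,
      (add_sub_cancel u u').symm, by abel⟩
    rw [hgrad']
    exact zero_mem _
  · rintro ⟨c, ⟨hcD, hc⟩, rfl, rfl⟩
    have hgc := PhiHarmonic.grad_eq_zero_of_invariant (S := S) hc
    refine ⟨hC.1 (add_mem hu (hY.mem_dirichletClosure_of_grad_eq_zero hΦ_delta hgc)),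
      ⟨hD.1 ?_, fun x => ?_⟩, by abel⟩
    · rw [map_sub, hgc, sub_zero]
      exact hh
    · rw [PhiHarmonic.phiLaplacian_sub_of_invariant Φ S _ hc]
      exact hharm x
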